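/- Let $M$ be a compact connected (Hausdorff) smooth manifold, possibly with boundary, whose first integral singular homology $H_1(M;\mathbb Z)$ is free of finite rank $b$; fix a basis, so that $H_1(M;\mathbb Z)\cong\mathbb Z^b$. Let $f:M\to M$ be continuous and let $A$ be the $b\times b$ integer matrix of $f_*:H_1(M;\mathbb Z)\to H_1(M;\mathbb Z)$. Let $\pi:\tilde M_a\to M$ be the universal Abelian cover of $M$, i.e. the quotient of the universal cover by the commutator subgroup of the fundamental group. Its deck group is $\mathbb Z^b$: if the universal cover is described as the set of homotopy classes $[\alpha]$ of paths starting at a base point $x_0$, then the deck transformation $\delta_{\vec n}$ is induced by $[\alpha]\mapsto[\ell\cdot\alpha]$ for any loop $\ell$ at $x_0$ with homology class $\vec n$. A lift of $f$ is a continuous map $\tilde f:\tilde M_a\to\tilde M_a$ with $\pi\circ\tilde f=f\circ\pi$. For a fixed point $x$ of $f$ and a lift $\tilde f$, the displacement of $x$ is $$D(x,\tilde f)=\vec n+(A-I)\mathbb Z^b\ \in\ \mathrm{BF}_1(f)=\mathbb Z^b/(A-I)\mathbb Z^b ,$$ where $\tilde f(\tilde x)=\delta_{\vec n}\tilde x$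 for any $\tilde x\in\pi^{-1}(x)$; it does not depend on the choice of $\tilde x$. Then for fixed points $x,x'$ of $f$ the following are equivalent. (1) $D(x,\tilde f)=D(x',\tilde f)$ for some lift $\tilde f$ of $f$. (2) There are a lift $\tilde f$ of $f$ and points $\tilde x\in\pi^{-1}(x)$, $\tilde x'\in\pi^{-1}(x')$ with $\tilde f(\tilde x)=\tilde x$ and $\tilde f(\tilde x')=\tilde x'$. (3) There is a path $\gamma:[0,1]\to M$ from $x$ to $x'$ that is homologous to $f\circ\gamma$ rel endpoints, i.e. the singular $1$-chain $f\circ\gamma-\gamma$ is the boundary of an integral singular $2$-chain. -/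

import Mathlib

open scoped ContDiff Manifold

universe u

namespace AbelianDisplacement

noncomputable section

open CategoryTheory AlgebraicTopology

section Homology

/-- The integral singular chain complex of the space `M`
(`ULift ℤ` is the group `ℤ`, placed in the universe of `M`). -/
abbrev singularChains (M : Type u) [TopologicalSpace M] : ChainComplex (ModuleCat.{u} ℤ) ℕ :=
  ((singularChainComplexFunctor (ModuleCat.{u} ℤ)).obj (ModuleCat.of ℤ (ULift.{u} ℤ))).obj
    (TopCat.of M)

/-- The first integral singular homology group `H₁(M; ℤ)`. -/
abbrev H1 (M : Type u) [TopologicalSpace M] : ModuleCat.{u} ℤ :=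
  ((singularHomologyFunctor (ModuleCat.{u} ℤ) 1).obj (ModuleCat.of ℤ (ULift.{u} ℤ))).obj
    (TopCat.of M)

/-- The map `f_* : H₁(M; ℤ) → H₁(M; ℤ)` induced by a continuous map. -/
def H1map {M : Type u} [TopologicalSpace M] (f : C(M, M)) : H1 M →ₗ[ℤ] H1 M :=
  (((singularHomologyFunctor (ModuleCat.{u} ℤ) 1).obj (ModuleCat.of ℤ (ULift.{u} ℤ))).map
    (TopCat.ofHom f)).hom

variable {M : Type u} [TopologicalSpace M]

/-- A path, seen as a singular 1-simplex: `(s₀, s₁) ↦ γ s₁`. -/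
def pathSimplex {x y : M} (γ : Path x y) :
    (TopCat.toSSet.obj (TopCat.of M)).obj (.op (.mk 1)) :=
  (TopCat.toSSetObjEquiv (TopCat.of M) (.op (.mk 1))).symm
    (γ.toContinuousMap.comp
      ⟨stdSimplexHomeomorphUnitInterval, stdSimplexHomeomorphUnitInterval.continuous⟩)

/-- A path, seen as a singular 1-chain (its simplex with coefficient one). -/
def pathChain {x y : M} (γ : Path x y) : (singularChains M).X 1 :=
  (SSet.ιChainComplex (TopCat.toSSet.obj (TopCat.of M))
    (R := ModuleCat.of ℤ (ULift.{u} ℤ)) (pathSimplex γ)).hom (ULift.up 1)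

/-- Two paths with the same endpoints are homologous rel endpoints: their difference is the
boundary of a singular 2-chain. -/
def HomologousRel {x y : M} (γ γ' : Path x y) : Prop :=
  ∃ c : (singularChains M).X 2, ((singularChains M).d 2 1).hom c = pathChain γ' - pathChain γ

/-- `h ∈ H₁(M; ℤ)` is the homology class of the loop `l`, i.e. of the singular cycle
given by `l`. -/
def IsHomologyClass {x : M} (l : Path x x) (h : H1 M) : Prop :=
  ∃ z : (singularChains M).cycles 1,
    ((singularChains M).iCycles 1).hom z = pathChain l ∧ ((singularChains M).homologyπ 1).hom z = h

end Homology

section Cover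

/-- The points of the universal cover of `M` with base point `x₀`: homotopy classes rel endpoints
of paths in `M` starting at `x₀`. -/
structure UniversalCover {M : Type u} [TopologicalSpace M] (x₀ : M) where
  /-- the endpoint, that is, the projection to `M` -/
  endpoint : M
  /-- the class of paths -/
  cls : Path.Homotopic.Quotient x₀ endpoint

variable {M : Type u} [TopologicalSpace M] {x₀ : M}

/-- For `a = [α]` and `U ⊆ M`, the set of all classes `[α · η]`, where `η` is a path in `U`
that starts at the endpoint of `α`. -/
def UniversalCover.sheet (a : UniversalCover x₀) (U : Set M) : Set (UniversalCover x₀) :=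
  {b | ∃ η : Path a.endpoint b.endpoint, (∀ t, η t ∈ U) ∧
    b.cls = a.cls.trans (Path.Homotopic.Quotient.mk η)}

/-- The usual topology of the universal cover, with basis the sets `a.sheet U` for `U` open. -/
instance : TopologicalSpace (UniversalCover x₀) :=
  TopologicalSpace.generateFrom
    {V | ∃ (a : UniversalCover x₀) (U : Set M), IsOpen U ∧ a.endpoint ∈ U ∧ V = a.sheet U}

/-- The action of the class of a loop at `x₀` on the universal cover: `[α] ↦ [l · α]`. -/
def UniversalCover.act (l : FundamentalGroup M x₀) (a : UniversalCover x₀) : UniversalCover x₀ :=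
  ⟨a.endpoint, l.toPath.trans a.cls⟩

theorem UniversalCover.act_act (k l : FundamentalGroup M x₀) (a : UniversalCover x₀) :
    act k (act l a) = act (l * k) a := by
  simp only [act, FundamentalGroup.mul_def, FundamentalGroup.toPath, FundamentalGroup.toArrow,
    Path.Homotopic.Quotient.trans_assoc]

theorem UniversalCover.act_one (a : UniversalCover x₀) : act 1 a = a := by
  simp only [act, FundamentalGroup.one_def, FundamentalGroup.toPath, FundamentalGroup.toArrow,
    Path.Homotopic.Quotient.refl_trans]

/-- Two points of the universal cover are identified when they lie in one orbit of the
commutator subgroup of the fundamental group. -/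
def commutatorSetoid (x₀ : M) : Setoid (UniversalCover x₀) where
  r a b := ∃ l ∈ commutator (FundamentalGroup M x₀), b = UniversalCover.act l a
  iseqv :=
    { refl := fun a => ⟨1, one_mem _, (UniversalCover.act_one a).symm⟩
      symm := by
        rintro a b ⟨l, hl, rfl⟩
        exact ⟨l⁻¹, inv_mem hl, by
          rw [UniversalCover.act_act, mul_inv_cancel, UniversalCover.act_one]⟩
      trans := by
        rintro a b c ⟨l, hl, rfl⟩ ⟨k, hk, rfl⟩
        exact ⟨l * k, mul_mem hl hk, UniversalCover.act_act k l a⟩ }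

/-- The universal Abelian cover of `M`: the quotient of the universal cover by the action of the
commutator subgroup of the fundamental group. -/
def AbelianCover (x₀ : M) : Type u := Quotient (commutatorSetoid x₀)

instance : TopologicalSpace (AbelianCover x₀) :=
  inferInstanceAs (TopologicalSpace (Quotient (commutatorSetoid x₀)))

/-- The projection of the universal Abelian cover to `M`. -/
def AbelianCover.proj (e : AbelianCover x₀) : M :=
  Quotient.lift (s := commutatorSetoid x₀) UniversalCover.endpoint
    (by rintro a b ⟨l, -, rfl⟩; rfl) e

/-- The deck transformation `[α] ↦ [l · α]` of the universal Abelian cover given by the class of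
a loop `l` at `x₀`. -/
def AbelianCover.deck (l : FundamentalGroup M x₀) : AbelianCover x₀ → AbelianCover x₀ :=
  Quotient.map' (s₁ := commutatorSetoid x₀) (s₂ := commutatorSetoid x₀) (UniversalCover.act l) (by
    rintro a b ⟨k, hk, rfl⟩
    refine ⟨l⁻¹ * k * l, ?_, ?_⟩
    · have : (commutator (FundamentalGroup M x₀)).Normal := inferInstance
      simpa using this.conj_mem k hk l⁻¹
    · rw [UniversalCover.act_act, UniversalCover.act_act]
      congr 1
      group)

/-- `F` is a lift of `f` to the universal Abelian cover. -/
def IsLift (f : C(M, M)) (F : C(AbelianCover x₀, AbelianCover x₀)) : Prop :=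
  ∀ e, (F e).proj = f e.proj

end Cover

section Displacement

variable {M : Type u} [TopologicalSpace M] {b : ℕ} (Γ : Module.Basis (Fin b) ℤ (H1 M))

/-- `δ` is the deck transformation `δ_n` of the universal Abelian cover that corresponds to
`n ∈ ℤ^b ≅ H₁(M; ℤ)`: it is given by a loop with homology class `∑ i, n i • Γ i`. -/
def IsDeckTransformation {x₀ : M} (n : Fin b → ℤ) (δ : AbelianCover x₀ → AbelianCover x₀) : Prop :=
  ∃ l : Path x₀ x₀, IsHomologyClass l (∑ i, n i • Γ i) ∧
    δ = AbelianCover.deck (FundamentalGroup.fromPath (Path.Homotopic.Quotient.mk l))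

/-- The integer matrix `A` of `f_* : H₁(M; ℤ) → H₁(M; ℤ)` in the basis `Γ`. -/
def homologyMatrix (f : C(M, M)) : Matrix (Fin b) (Fin b) ℤ :=
  LinearMap.toMatrix Γ Γ (H1map f)

/-- The subgroup `(A - I) ℤ^b` of `ℤ^b`. -/
def imageAsubI (f : C(M, M)) : Submodule ℤ (Fin b → ℤ) :=
  LinearMap.range (homologyMatrix Γ f - 1).mulVecLin

/-- The Bowen-Franks group `BF₁(f) = ℤ^b / (A - I) ℤ^b`. -/
abbrev BF1 (f : C(M, M)) : Type := (Fin b → ℤ) ⧸ imageAsubI Γ f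

/-- `d ∈ BF₁(f)` is the displacement `D(x, F)` of the fixed point `x` of `f` under the lift `F`:
for any lift `e` of `x` one has `F e = δ_n e` for some `n` that represents `d`. -/
def IsDisplacement (f : C(M, M)) {x₀ : M} (F : C(AbelianCover x₀, AbelianCover x₀)) (x : M)
    (d : BF1 Γ f) : Prop :=
  ∀ e : AbelianCover x₀, e.proj = x →
    ∃ (n : Fin b → ℤ) (δ : AbelianCover x₀ → AbelianCover x₀),
      IsDeckTransformation Γ n δ ∧ F e = δ e ∧ (imageAsubI Γ f).mkQ n = d

end Displacement

end

end AbelianDisplacement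

/-! Everything is computed in the group `chainClasses M` of singular 1-chains modulo boundaries,
which contains $H_1$. Every path, closed or not, has a class there. The class depends only on the
homotopy class of the path, turns concatenation into addition, and is natural in `f`.

The two halves of the Hurewicz theorem (`exists_homotopyClassChain_eq`,
`mem_commutator_of_homotopyClassChain_eq_zero`) tie this group to the cover. Each homology class is
the class of a loop at `x₀`, and a loop of class zero lies in the commutator subgroup. So two points
of one fibre of the Abelian cover coincide exactly when their paths have the same chain class
(`AbelianCover.mk_eq_mk_iff`). Uniqueness of lifts shows that every lift of `f` is
$[\alpha]\mapsto[c\cdot f\alpha]$ for some path $c$ from $x_0$ to $f(x_0)$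
(`AbelianCover.exists_eq_lift`).

Over a fixed point, writing paths for their classes, $\tilde f[a]=[a]$ becomes $c+f_*a=a$, and
displacement $n$ becomes $c+f_*a=n+a$. The rest is linear algebra. Replacing $a$ by $m+a$ changes
$n$ by $(A-I)m$, and replacing $c$ by $c-n$ makes a displacement zero. If $c$ solves the fixed point
equation for both $a$ and $a'$, subtraction gives $f_*(a'-a)=a'-a$, which is condition (3) for
$\gamma=a^{-1}a'$. Conversely, such a $\gamma$ carries a solution for $a$ to one for $a\gamma$. -/

namespace AbelianDisplacement

noncomputable section

open CategoryTheory AlgebraicTopology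

/-! ### Singular chain groups as free groups on simplices -/

section Chains

variable {M : Type u} [TopologicalSpace M]

/-- The singular chain given by one singular simplex with coefficient one. -/
def simplexChain {n : ℕ} (σ : (TopCat.toSSet.obj (TopCat.of M)).obj (.op (.mk n))) :
    (singularChains M).X n :=
  (SSet.ιChainComplex (TopCat.toSSet.obj (TopCat.of M))
    (R := ModuleCat.of ℤ (ULift.{u} ℤ)) σ).hom (ULift.up 1)

theorem pathChain_eq_simplexChain {x y : M} (γ : Path x y) :
    pathChain γ = simplexChain (pathSimplex γ) := rfl

theorem boundary_simplexChain {n : ℕ}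
    (σ : (TopCat.toSSet.obj (TopCat.of M)).obj (.op (.mk (n + 1)))) :
    ((singularChains M).d (n + 1) n).hom (simplexChain σ) =
      ∑ i : Fin (n + 2), (-1 : ℤ) ^ (i : ℕ) •
        simplexChain ((TopCat.toSSet.obj (TopCat.of M)).δ i σ) := by
  have h := congrArg (fun φ => φ.hom (ULift.up (1 : ℤ)))
    (SSet.ιChainComplex_d (R := ModuleCat.of ℤ (ULift.{u} ℤ)) (TopCat.toSSet.obj (TopCat.of M)) σ)
  refine h.trans ?_
  simp only [ModuleCat.hom_sum, ModuleCat.hom_smul, LinearMap.sum_apply, LinearMap.smul_apply]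
  rfl

/-- Additive maps are automatically ℤ-linear, so the universal property of the coproduct defining
the chain group applies. -/
theorem simplexChain_ext {n : ℕ} {A : Type u} [AddCommGroup A]
    {φ ψ : (singularChains M).X n →+ A}
    (h : ∀ σ, φ (simplexChain σ) = ψ (simplexChain σ)) : φ = ψ := by
  let φ' : (singularChains M).X n ⟶ ModuleCat.of ℤ A := ModuleCat.ofHom
    { φ with map_smul' := fun k c => map_intCast_smul φ ℤ ℤ k c }
  let ψ' : (singularChains M).X n ⟶ ModuleCat.of ℤ A := ModuleCat.ofHom
    { ψ with map_smul' := fun k c => map_intCast_smul ψ ℤ ℤ k c }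
  have : φ' = ψ' := by
    refine SSet.chainComplex_hom_ext fun σ => ?_
    refine ModuleCat.hom_ext (LinearMap.ext fun k => ?_)
    have hk : k = k.down • (ULift.up 1 : ULift.{u} ℤ) := ULift.ext _ _ (by simp)
    rw [hk, map_smul, map_smul]
    exact congrArg (k.down • ·) (h σ)
  ext c
  exact congrArg (fun χ => χ.hom c) this

/-- The quotient map by the subgroup that the simplices generate kills every simplex, so it is zero.
-/
theorem closure_simplexChain (n : ℕ) :
    AddSubgroup.closure (Set.range (simplexChain (M := M) (n := n))) = ⊤ := by
  have h : QuotientAddGroup.mk' (AddSubgroup.closure (Set.range (simplexChain (M := M) (n := n)))) =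
      0 := by
    refine simplexChain_ext fun σ => ?_
    rw [AddMonoidHom.zero_apply, QuotientAddGroup.mk'_apply, QuotientAddGroup.eq_zero_iff]
    exact AddSubgroup.subset_closure (Set.mem_range_self σ)
  rw [← QuotientAddGroup.ker_mk' (AddSubgroup.closure _), h, AddMonoidHom.ker_zero]

theorem simplexChain_induction {n : ℕ} {p : (singularChains M).X n → Prop}
    (simplex : ∀ σ, p (simplexChain σ)) (zero : p 0) (add : ∀ c d, p c → p d → p (c + d))
    (neg : ∀ c, p c → p (-c)) (c : (singularChains M).X n) : p c := by
  have hc : c ∈ AddSubgroup.closure (Set.range (simplexChain (M := M) (n := n))) := by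
    rw [closure_simplexChain]; trivial
  induction hc using AddSubgroup.closure_induction with
  | mem c hc => obtain ⟨σ, rfl⟩ := hc; exact simplex σ
  | zero => exact zero
  | add c d _ _ hc hd => exact add c d hc hd
  | neg c _ hc => exact neg c hc

/-- Freeness of the chain groups, the source of the homomorphisms that both halves of the Hurewicz
theorem need. -/
theorem exists_simplexChain_lift {n : ℕ} {A : Type u} [AddCommGroup A]
    (g : (TopCat.toSSet.obj (TopCat.of M)).obj (.op (.mk n)) → A) :
    ∃ φ : (singularChains M).X n →+ A, ∀ σ, φ (simplexChain σ) = g σ := by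
  let X := TopCat.toSSet.obj (TopCat.of M)
  let R := ModuleCat.of ℤ (ULift.{u} ℤ)
  let t (σ : X.obj (.op (.mk n))) : R ⟶ ModuleCat.of ℤ A :=
    ModuleCat.ofHom (((LinearMap.toSpanSingleton ℤ A (g σ))).comp
      (ULift.moduleEquiv (R := ℤ) (M := ℤ)).toLinearMap)
  refine ⟨((X.isColimitChainComplexXCofan R n).desc
    (Limits.Cofan.mk _ t)).hom.toAddMonoidHom, fun σ => ?_⟩
  have h := congrArg (fun φ => φ.hom (ULift.up (1 : ℤ)))
    ((X.isColimitChainComplexXCofan R n).fac (Limits.Cofan.mk _ t) ⟨σ⟩)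
  refine h.trans ?_
  change (1 : ℤ) • g σ = _
  simp

/-- The chain map induced by a continuous map. -/
abbrev chainsMap (f : C(M, M)) : singularChains M ⟶ singularChains M :=
  ((singularChainComplexFunctor (ModuleCat.{u} ℤ)).obj (ModuleCat.of ℤ (ULift.{u} ℤ))).map
    (TopCat.ofHom f)

theorem chainsMap_pathChain (f : C(M, M)) {x y : M} (γ : Path x y) :
    ((chainsMap f).f 1).hom (pathChain γ) = pathChain (γ.map f.continuous) := by
  have h := congrArg (fun φ => φ.hom (ULift.up (1 : ℤ)))
    (SSet.ι_chainComplexMap_f _ _ (TopCat.toSSet.map (TopCat.ofHom f))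
      (ModuleCat.of ℤ (ULift.{u} ℤ)) (pathSimplex γ))
  exact h

end Chains

/-! ### Paths as 1-simplices and the faces of a 2-simplex -/

section PathSimplex

variable {M : Type u} [TopologicalSpace M]

theorem pathSimplex_eq_iff {x y : M} (γ : Path x y)
    (σ : (TopCat.toSSet.obj (TopCat.of M)).obj (.op (.mk 1))) :
    pathSimplex γ = σ ↔ ∀ u : stdSimplex ℝ (Fin 2), γ (stdSimplexHomeomorphUnitInterval u) =
      TopCat.toSSetObjEquiv (TopCat.of M) (.op (.mk 1)) σ u := by
  rw [pathSimplex, Equiv.symm_apply_eq, ContinuousMap.ext_iff]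
  rfl

theorem pathSimplex_eq_pathSimplex_iff {x y x' y' : M} (γ : Path x y) (γ' : Path x' y') :
    pathSimplex γ = pathSimplex γ' ↔ ∀ t, γ t = γ' t := by
  rw [pathSimplex_eq_iff]
  refine ⟨fun h t => ?_, fun h u => h _⟩
  obtain ⟨u, rfl⟩ := stdSimplexHomeomorphUnitInterval.surjective t
  exact h u

theorem pathChain_cast {x y x' y' : M} (γ : Path x y) (hx : x' = x) (hy : y' = y) :
    pathChain (γ.cast hx hy) = pathChain γ := by
  rw [pathChain_eq_simplexChain, pathChain_eq_simplexChain,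
    (pathSimplex_eq_pathSimplex_iff (γ.cast hx hy) γ).2 fun _ => rfl]

/-- A singular 1-simplex, seen as a path. -/
def simplexPath (σ : (TopCat.toSSet.obj (TopCat.of M)).obj (.op (.mk 1))) :
    Path (X := M)
      (TopCat.toSSetObjEquiv (TopCat.of M) (.op (.mk 1)) σ (stdSimplex.vertex (0 : Fin 2)))
      (TopCat.toSSetObjEquiv (TopCat.of M) (.op (.mk 1)) σ (stdSimplex.vertex (1 : Fin 2))) where
  toFun t := TopCat.toSSetObjEquiv (TopCat.of M) (.op (.mk 1)) σ
    (stdSimplexHomeomorphUnitInterval.symm t)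
  continuous_toFun := (map_continuous _).comp stdSimplexHomeomorphUnitInterval.symm.continuous
  source' := by
    congr 1
    rw [Homeomorph.symm_apply_eq]
    exact stdSimplexHomeomorphUnitInterval_zero.symm
  target' := by
    congr 1
    rw [Homeomorph.symm_apply_eq]
    exact stdSimplexHomeomorphUnitInterval_one.symm

theorem pathSimplex_simplexPath (σ : (TopCat.toSSet.obj (TopCat.of M)).obj (.op (.mk 1))) :
    pathSimplex (simplexPath σ) = σ := by
  rw [pathSimplex_eq_iff]
  intro u
  simp [simplexPath]

/-- The 2-simplex of a continuous map on the standard 2-simplex. -/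
abbrev triangle (s : C(stdSimplex ℝ (Fin 3), M)) :
    (TopCat.toSSet.obj (TopCat.of M)).obj (.op (.mk 2)) :=
  (TopCat.toSSetObjEquiv (TopCat.of M) (.op (.mk 2))).symm s

theorem pathSimplex_eq_face_iff (s : C(stdSimplex ℝ (Fin 3), M)) (i : Fin 3) {x y : M}
    (γ : Path x y) :
    pathSimplex γ = (TopCat.toSSet.obj (TopCat.of M)).δ i (triangle s) ↔
      ∀ u : stdSimplex ℝ (Fin 2), γ (stdSimplexHomeomorphUnitInterval u) =
        s (stdSimplex.map i.succAbove u) := by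
  rw [pathSimplex_eq_iff]
  rfl

theorem boundary_triangle (s : C(stdSimplex ℝ (Fin 3), M)) {x₀ x₁ x₂ y₀ y₁ y₂ : M}
    (p : Path x₀ y₀) (q : Path x₁ y₁) (r : Path x₂ y₂)
    (hp : pathSimplex p = (TopCat.toSSet.obj (TopCat.of M)).δ 2 (triangle s))
    (hq : pathSimplex q = (TopCat.toSSet.obj (TopCat.of M)).δ 0 (triangle s))
    (hr : pathSimplex r = (TopCat.toSSet.obj (TopCat.of M)).δ 1 (triangle s)) :
    ((singularChains M).d 2 1).hom (simplexChain (triangle s)) =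
      pathChain p + pathChain q - pathChain r := by
  rw [boundary_simplexChain, Fin.sum_univ_three, pathChain_eq_simplexChain,
    pathChain_eq_simplexChain, pathChain_eq_simplexChain, hp, hq, hr]
  simp
  abel

theorem map_succAbove_zero (u : stdSimplex ℝ (Fin 2)) :
    (stdSimplex.map (0 : Fin 3).succAbove u : Fin 3 → ℝ) = ![0, u 0, u 1] := by
  funext j
  rw [stdSimplex.map_coe, FunOnFinite.linearMap_apply_apply, Finset.sum_filter, Fin.sum_univ_two]
  fin_cases j <;> simp [Fin.succAbove]

theorem map_succAbove_one (u : stdSimplex ℝ (Fin 2)) :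
    (stdSimplex.map (1 : Fin 3).succAbove u : Fin 3 → ℝ) = ![u 0, 0, u 1] := by
  funext j
  rw [stdSimplex.map_coe, FunOnFinite.linearMap_apply_apply, Finset.sum_filter, Fin.sum_univ_two]
  fin_cases j <;> simp [Fin.succAbove]

theorem map_succAbove_two (u : stdSimplex ℝ (Fin 2)) :
    (stdSimplex.map (2 : Fin 3).succAbove u : Fin 3 → ℝ) = ![u 0, u 1, 0] := by
  funext j
  rw [stdSimplex.map_coe, FunOnFinite.linearMap_apply_apply, Finset.sum_filter, Fin.sum_univ_two]
  fin_cases j <;> simp [Fin.succAbove]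

end PathSimplex

/-! ### Classes of paths modulo boundaries -/

section PathClass

variable {M : Type u} [TopologicalSpace M]

/-- Singular 1-chains modulo boundaries. -/
abbrev chainClasses (M : Type u) [TopologicalSpace M] : ModuleCat.{u} ℤ :=
  (singularChains M).opcycles 1

/-- The class modulo boundaries of a path, seen as a singular 1-chain. -/
def pathClass {x y : M} (γ : Path x y) : chainClasses M :=
  ((singularChains M).pOpcycles 1).hom (pathChain γ)

/-- The inclusion of the first homology group in the 1-chains modulo boundaries. -/
abbrev homologyInclusion (M : Type u) [TopologicalSpace M] : H1 M →ₗ[ℤ] chainClasses M :=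
  ((singularChains M).homologyι 1).hom

theorem homologyInclusion_injective : Function.Injective (homologyInclusion M) :=
  (ModuleCat.mono_iff_injective ((singularChains M).homologyι 1)).1 inferInstance

theorem pOpcycles_boundary (c : (singularChains M).X 2) :
    ((singularChains M).pOpcycles 1).hom (((singularChains M).d 2 1).hom c) = 0 :=
  congrArg (fun φ => φ.hom c) ((singularChains M).d_pOpcycles 2 1)

theorem pOpcycles_eq_zero_iff (c : (singularChains M).X 1) :
    ((singularChains M).pOpcycles 1).hom c = 0 ↔
      ∃ e : (singularChains M).X 2, ((singularChains M).d 2 1).hom e = c := by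
  constructor
  · have h := ShortComplex.exact_of_g_is_cokernel
      (ShortComplex.mk _ _ ((singularChains M).d_pOpcycles 2 1))
      ((singularChains M).opcyclesIsCokernel 2 1 (by simp))
    rw [ShortComplex.moduleCat_exact_iff] at h
    exact h c
  · rintro ⟨e, rfl⟩
    exact pOpcycles_boundary e

theorem pOpcycles_surjective : Function.Surjective ((singularChains M).pOpcycles 1).hom :=
  (ModuleCat.epi_iff_surjective ((singularChains M).pOpcycles 1)).1 inferInstance

theorem fromOpcycles_pOpcycles (c : (singularChains M).X 1) :
    ((singularChains M).fromOpcycles 1 0).hom (((singularChains M).pOpcycles 1).hom c) =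
      ((singularChains M).d 1 0).hom c :=
  congrArg (fun φ => φ.hom c) ((singularChains M).p_fromOpcycles 1 0)

theorem fromOpcycles_eq_zero_iff (c : chainClasses M) :
    ((singularChains M).fromOpcycles 1 0).hom c = 0 ↔ ∃ h, homologyInclusion M h = c := by
  constructor
  · have h := ShortComplex.exact_of_f_is_kernel
      (ShortComplex.mk _ _ ((singularChains M).homologyι_comp_fromOpcycles 1 0))
      ((singularChains M).homologyIsKernel 1 0 (by simp))
    rw [ShortComplex.moduleCat_exact_iff] at h
    exact h c
  · rintro ⟨e, rfl⟩
    exact congrArg (fun φ => φ.hom e) ((singularChains M).homologyι_comp_fromOpcycles 1 0)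

theorem homologousRel_iff {x y : M} (γ γ' : Path x y) :
    HomologousRel γ γ' ↔ pathClass γ' = pathClass γ := by
  rw [HomologousRel, ← pOpcycles_eq_zero_iff, map_sub, sub_eq_zero]
  rfl

theorem isHomologyClass_iff {x : M} (l : Path x x) (h : H1 M) :
    IsHomologyClass l h ↔ homologyInclusion M h = pathClass l := by
  have key (z) : homologyInclusion M (((singularChains M).homologyπ 1).hom z) =
      ((singularChains M).pOpcycles 1).hom (((singularChains M).iCycles 1).hom z) :=
    congrArg (fun φ => φ.hom z) ((singularChains M).homology_π_ι 1)
  constructor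
  · rintro ⟨z, hz, rfl⟩
    rw [key, hz, pathClass]
  · intro H
    have hd : ((singularChains M).d 1 0).hom (pathChain l) = 0 := by
      rw [← fromOpcycles_pOpcycles]
      exact (fromOpcycles_eq_zero_iff _).2 ⟨h, H⟩
    have hex := ShortComplex.exact_of_f_is_kernel
      (ShortComplex.mk _ _ ((singularChains M).iCycles_d 1 0))
      ((singularChains M).cyclesIsKernel 1 0 (by simp))
    rw [ShortComplex.moduleCat_exact_iff] at hex
    obtain ⟨z, hz⟩ := hex (pathChain l) hd
    refine ⟨z, hz, homologyInclusion_injective ?_⟩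
    rw [key, H, pathClass]
    exact congrArg _ hz

theorem pathClass_cast {x y x' y' : M} (γ : Path x y) (hx : x' = x) (hy : y' = y) :
    pathClass (γ.cast hx hy) = pathClass γ := by
  rw [pathClass, pathChain_cast, pathClass]

/-- The boundary relation of one 2-simplex in barycentric coordinates: each edge is parametrised by
the coordinate of its later vertex. -/
theorem pathClass_add_of_triangle (s : C(stdSimplex ℝ (Fin 3), M)) {x₀ x₁ x₂ y₀ y₁ y₂ : M}
    (p : Path x₀ y₀) (q : Path x₁ y₁) (r : Path x₂ y₂)
    (hp : ∀ w : stdSimplex ℝ (Fin 3), w 2 = 0 → ∀ t : unitInterval, (t : ℝ) = w 1 → s w = p t)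
    (hq : ∀ w : stdSimplex ℝ (Fin 3), w 0 = 0 → ∀ t : unitInterval, (t : ℝ) = w 2 → s w = q t)
    (hr : ∀ w : stdSimplex ℝ (Fin 3), w 1 = 0 → ∀ t : unitInterval, (t : ℝ) = w 2 → s w = r t) :
    pathClass p + pathClass q = pathClass r := by
  have h := boundary_triangle s p q r
    ((pathSimplex_eq_face_iff s 2 p).2 fun u => (hp _ ?_ _ ?_).symm)
    ((pathSimplex_eq_face_iff s 0 q).2 fun u => (hq _ ?_ _ ?_).symm)
    ((pathSimplex_eq_face_iff s 1 r).2 fun u => (hr _ ?_ _ ?_).symm)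
  · have h' := congrArg ((singularChains M).pOpcycles 1).hom h
    rw [pOpcycles_boundary, map_sub, map_add] at h'
    exact (sub_eq_zero.1 h'.symm)
  all_goals
    simp only [map_succAbove_zero, map_succAbove_one, map_succAbove_two]
    rfl

/-- The constant 2-simplex gives $e+e=e$. -/
theorem pathClass_refl (x : M) : pathClass (Path.refl x) = 0 := by
  have h := pathClass_add_of_triangle (ContinuousMap.const _ x) (Path.refl x) (Path.refl x)
    (Path.refl x) (fun _ _ _ _ => rfl) (fun _ _ _ _ => rfl) (fun _ _ _ _ => rfl)
  simpa using h

theorem simplexThree_sum (w : stdSimplex ℝ (Fin 3)) : w 0 + w 1 + w 2 = 1 := by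
  rw [← Fin.sum_univ_three]
  exact stdSimplex.sum_eq_one w

theorem pathClass_trans {x y z : M} (p : Path x y) (q : Path y z) :
    pathClass (p.trans q) = pathClass p + pathClass q := by
  symm
  -- The affine collapse of the triangle onto $[0,1]$ that sends its vertices to $0$, $1/2$, $1$,
  -- followed by the concatenated path.
  let s : C(stdSimplex ℝ (Fin 3), M) :=
    ⟨fun w => (p.trans q) ⟨w 1 / 2 + w 2, by
      have h := simplexThree_sum w
      have h0 := stdSimplex.zero_le w 0
      have h1 := stdSimplex.zero_le w 1
      have h2 := stdSimplex.zero_le w 2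
      constructor <;> linarith⟩, by
      refine (p.trans q).continuous.comp (Continuous.subtype_mk ?_ _)
      exact ((continuous_apply 1).comp continuous_subtype_val).div_const 2 |>.add
        ((continuous_apply 2).comp continuous_subtype_val)⟩
  refine pathClass_add_of_triangle s p q _ ?_ ?_ ?_
  · intro w hw t ht
    change (p.trans q) _ = _
    rw [Path.trans_apply, dif_pos (by simp only [hw]; linarith [stdSimplex.le_one w 1])]
    congr 1
    ext
    simp only [hw, ht]
    ring
  · intro w hw t ht
    have h := simplexThree_sum w
    have h0 := stdSimplex.zero_le w 2
    change (p.trans q) _ = _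
    rw [Path.trans_apply]
    split_ifs with hs
    -- The two halves of the concatenation overlap only at the midpoint, which forces `w 2 = 0`.
    · simp only at hs
      have e1 : w 2 = 0 := by linarith
      have e2 : w 1 = 1 := by linarith
      have : t = 0 := Subtype.ext (ht.trans e1)
      rw [this, q.source]
      convert p.target
      simp only [e1, e2]
      norm_num
    · congr 1
      ext
      simp only [ht]
      linarith
  · intro w hw t ht
    change (p.trans q) _ = _
    congr 1
    ext
    simp only [ht, hw]
    ring

/-- The square of the homotopy is cut along its diagonal. Each of the two triangles has one constant
edge, so both `p` and `q` have the class of the diagonal `D`. -/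
theorem pathClass_eq_of_homotopic {x y : M} {p q : Path x y} (h : p.Homotopic q) :
    pathClass p = pathClass q := by
  obtain ⟨F⟩ := h
  have hw1 (w : stdSimplex ℝ (Fin 3)) : w 1 + w 2 ∈ unitInterval := by
    have h := simplexThree_sum w
    have h0 := stdSimplex.zero_le w 0
    have h1 := stdSimplex.zero_le w 1
    have h2 := stdSimplex.zero_le w 2
    constructor <;> linarith
  have hw2 (w : stdSimplex ℝ (Fin 3)) : w 2 ∈ unitInterval :=
    ⟨stdSimplex.zero_le w 2, stdSimplex.le_one w 2⟩
  have hc (i : Fin 3) : Continuous fun w : stdSimplex ℝ (Fin 3) => w i :=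
    (continuous_apply i).comp continuous_subtype_val
  let D : Path x y :=
    { toFun := fun t => F (t, t)
      source' := by simp
      target' := by simp }
  let s₁ : C(stdSimplex ℝ (Fin 3), M) :=
    ⟨fun w => F (⟨w 2, hw2 w⟩, ⟨w 1 + w 2, hw1 w⟩), by
      refine F.continuous.comp (Continuous.prodMk ?_ ?_) <;> refine Continuous.subtype_mk ?_ _
      · exact hc 2
      · exact (hc 1).add (hc 2)⟩
  let s₂ : C(stdSimplex ℝ (Fin 3), M) :=
    ⟨fun w => F (⟨w 1 + w 2, hw1 w⟩, ⟨w 2, hw2 w⟩), by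
      refine F.continuous.comp (Continuous.prodMk ?_ ?_) <;> refine Continuous.subtype_mk ?_ _
      · exact (hc 1).add (hc 2)
      · exact hc 2⟩
  have e₁ : pathClass p + pathClass (Path.refl y) = pathClass D := by
    refine pathClass_add_of_triangle s₁ _ _ _ ?_ ?_ ?_ <;> intro w hw t ht
    · have a : (⟨w 2, hw2 w⟩ : unitInterval) = 0 := Subtype.ext hw
      have b : (⟨w 1 + w 2, hw1 w⟩ : unitInterval) = t := Subtype.ext (by simp [hw, ht])
      change F (_, _) = _
      rw [a, b]
      simp
    · have b : (⟨w 1 + w 2, hw1 w⟩ : unitInterval) = 1 :=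
        Subtype.ext (by simpa [hw] using simplexThree_sum w)
      change F (_, _) = _
      rw [b]
      simp
    · have a : (⟨w 2, hw2 w⟩ : unitInterval) = t := Subtype.ext ht.symm
      have b : (⟨w 1 + w 2, hw1 w⟩ : unitInterval) = t := Subtype.ext (by simp [hw, ht])
      change F (_, _) = F _
      rw [a, b]
  have e₂ : pathClass (Path.refl x) + pathClass q = pathClass D := by
    refine pathClass_add_of_triangle s₂ _ _ _ ?_ ?_ ?_ <;> intro w hw t ht
    · have b : (⟨w 2, hw2 w⟩ : unitInterval) = 0 := Subtype.ext hw
      change F (_, _) = _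
      rw [b]
      simp
    · have a : (⟨w 1 + w 2, hw1 w⟩ : unitInterval) = 1 :=
        Subtype.ext (by simpa [hw] using simplexThree_sum w)
      have b : (⟨w 2, hw2 w⟩ : unitInterval) = t := Subtype.ext ht.symm
      change F (_, _) = _
      rw [a, b]
      simp
    · have a : (⟨w 2, hw2 w⟩ : unitInterval) = t := Subtype.ext ht.symm
      have b : (⟨w 1 + w 2, hw1 w⟩ : unitInterval) = t := Subtype.ext (by simp [hw, ht])
      change F (_, _) = F _
      rw [a, b]
  rw [pathClass_refl, add_zero] at e₁
  rw [pathClass_refl, zero_add] at e₂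
  rw [e₁, e₂]

theorem pathClass_symm {x y : M} (p : Path x y) : pathClass p.symm = -pathClass p := by
  have h : pathClass (Path.refl x) = pathClass (p.trans p.symm) :=
    pathClass_eq_of_homotopic ⟨Path.Homotopy.reflTransSymm p⟩
  rw [pathClass_refl, pathClass_trans] at h
  exact (neg_eq_of_add_eq_zero_right h.symm).symm

/-- The class modulo boundaries of a homotopy class of paths. -/
def homotopyClassChain {x y : M} (a : Path.Homotopic.Quotient x y) : chainClasses M :=
  Quotient.lift (s := Path.Homotopic.setoid x y) pathClass
    (fun _ _ h => pathClass_eq_of_homotopic h) a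

@[simp]
theorem homotopyClassChain_mk {x y : M} (γ : Path x y) :
    homotopyClassChain (Path.Homotopic.Quotient.mk γ) = pathClass γ := rfl

@[simp]
theorem homotopyClassChain_refl (x : M) :
    homotopyClassChain (Path.Homotopic.Quotient.refl x) = 0 :=
  pathClass_refl x

@[simp]
theorem homotopyClassChain_trans {x y z : M} (a : Path.Homotopic.Quotient x y)
    (b : Path.Homotopic.Quotient y z) :
    homotopyClassChain (a.trans b) = homotopyClassChain a + homotopyClassChain b := by
  induction a with | mk p => induction b with | mk q => exact pathClass_trans p q

@[simp]
theorem homotopyClassChain_symm {x y : M} (a : Path.Homotopic.Quotient x y) :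
    homotopyClassChain a.symm = -homotopyClassChain a := by
  induction a with | mk p => exact pathClass_symm p

@[simp]
theorem homotopyClassChain_cast {x y x' y' : M} (a : Path.Homotopic.Quotient x y)
    (hx : x' = x) (hy : y' = y) : homotopyClassChain (a.cast hx hy) = homotopyClassChain a := by
  induction a with | mk p => exact pathClass_cast p hx hy

/-- The map induced on 1-chains modulo boundaries by a continuous map. -/
abbrev chainClassesMap (f : C(M, M)) : chainClasses M →ₗ[ℤ] chainClasses M :=
  (HomologicalComplex.opcyclesMap (chainsMap f) 1).hom

theorem chainClassesMap_homologyInclusion (f : C(M, M)) (h : H1 M) :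
    chainClassesMap f (homologyInclusion M h) = homologyInclusion M (H1map f h) :=
  (congrArg (fun φ => φ.hom h) (HomologicalComplex.homologyι_naturality (chainsMap f) 1)).symm

@[simp]
theorem homotopyClassChain_map (f : C(M, M)) {x y : M} (a : Path.Homotopic.Quotient x y) :
    homotopyClassChain (a.map f) = chainClassesMap f (homotopyClassChain a) := by
  induction a with | mk p => ?_
  change ((singularChains M).pOpcycles 1).hom (pathChain (p.map f.continuous)) = _
  rw [← chainsMap_pathChain]
  exact (congrArg (fun φ => φ.hom (pathChain p))
    (HomologicalComplex.p_opcyclesMap (chainsMap f) 1)).symm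

/-- A point, seen as a singular 0-chain. -/
def pointChain (x : M) : (singularChains M).X 0 :=
  simplexChain ((TopCat.toSSetObjEquiv (TopCat.of M) (.op (.mk 0))).symm (ContinuousMap.const _ x))

theorem boundary_pathChain {x y : M} (γ : Path x y) :
    ((singularChains M).d 1 0).hom (pathChain γ) = pointChain y - pointChain x := by
  have h (i : Fin 2) (z : M)
      (hz : ∀ u : stdSimplex ℝ (Fin 1),
        γ (stdSimplexHomeomorphUnitInterval (stdSimplex.map i.succAbove u)) = z) :
      simplexChain ((TopCat.toSSet.obj (TopCat.of M)).δ i (pathSimplex γ)) = pointChain z := by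
    refine congrArg simplexChain ?_
    rw [Equiv.eq_symm_apply]
    ext u
    exact hz u
  rw [pathChain_eq_simplexChain, boundary_simplexChain, Fin.sum_univ_two, h 0 y, h 1 x]
  · simp [sub_eq_add_neg]
  all_goals
    intro u
    rw [Subsingleton.elim u (stdSimplex.vertex 0), stdSimplex.map_vertex]
  · exact γ.source
  · exact γ.target

theorem exists_homologyInclusion_eq {x : M} (a : Path.Homotopic.Quotient x x) :
    ∃ h, homologyInclusion M h = homotopyClassChain a := by
  induction a with | mk l => ?_
  rw [← fromOpcycles_eq_zero_iff, homotopyClassChain_mk, pathClass, fromOpcycles_pOpcycles,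
    boundary_pathChain, sub_self]

end PathClass

/-! ### The Hurewicz theorem in degree one -/

section Hurewicz

variable {M : Type u} [TopologicalSpace M]

/-- Let `ψ` send a point `y` to the class of a chosen path from `x₀` to `y`. For a 1-simplex
$\sigma$, the class of $\sigma$ minus $\psi(\partial\sigma)$ is that of $\sigma$ closed up to a loop
by the chosen paths. By additivity the same correction makes any chain a loop class, and on cycles
it vanishes. -/
theorem exists_homotopyClassChain_eq [PathConnectedSpace M] (x₀ : M) (h : H1 M) :
    ∃ a : Path.Homotopic.Quotient x₀ x₀, homotopyClassChain a = homologyInclusion M h := by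
  let P (y : M) : Path x₀ y := PathConnectedSpace.somePath x₀ y
  obtain ⟨ψ, hψ⟩ := exists_simplexChain_lift (M := M) (n := 0) (A := chainClasses M)
    fun σ => pathClass (P (TopCat.toSSetObjEquiv (TopCat.of M) (.op (.mk 0)) σ default))
  have hψ' (y : M) : ψ (pointChain y) = pathClass (P y) := hψ _
  have key (c : (singularChains M).X 1) : ∃ a : Path.Homotopic.Quotient x₀ x₀,
      homotopyClassChain a =
        ((singularChains M).pOpcycles 1).hom c - ψ (((singularChains M).d 1 0).hom c) := by
    induction c using simplexChain_induction with
    | simplex σ =>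
      let γ := simplexPath σ
      refine ⟨((Path.Homotopic.Quotient.mk (P _)).trans (.mk γ)).trans
        (Path.Homotopic.Quotient.mk (P _)).symm, ?_⟩
      have hσ : simplexChain σ = pathChain γ :=
        congrArg simplexChain (pathSimplex_simplexPath σ).symm
      rw [hσ, boundary_pathChain, map_sub, hψ', hψ']
      simp only [homotopyClassChain_trans, homotopyClassChain_symm, homotopyClassChain_mk]
      rw [pathClass.eq_def γ]
      abel
    | zero => exact ⟨.refl x₀, by simp⟩
    | add c d hc hd =>
      obtain ⟨a, ha⟩ := hc
      obtain ⟨b, hb⟩ := hd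
      refine ⟨a.trans b, ?_⟩
      simp only [homotopyClassChain_trans, ha, hb, map_add]
      abel
    | neg c hc =>
      obtain ⟨a, ha⟩ := hc
      refine ⟨a.symm, ?_⟩
      simp only [homotopyClassChain_symm, ha, map_neg]
      abel
  obtain ⟨c, hc⟩ := pOpcycles_surjective (homologyInclusion M h)
  obtain ⟨a, ha⟩ := key c
  have hd : ((singularChains M).d 1 0).hom c = 0 := by
    rw [← fromOpcycles_pOpcycles, hc]
    exact (fromOpcycles_eq_zero_iff _).2 ⟨h, rfl⟩
  exact ⟨a, by rw [ha, hd, hc, map_zero, sub_zero]⟩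

/-- The `i`-th face of the standard 2-simplex, seen as a path. -/
def facePath (i : Fin 3) : Path (X := stdSimplex ℝ (Fin 3)) (stdSimplex.vertex (i.succAbove 0))
    (stdSimplex.vertex (i.succAbove 1)) where
  toFun t := stdSimplex.map i.succAbove (stdSimplexHomeomorphUnitInterval.symm t)
  continuous_toFun := (stdSimplex.continuous_map _).comp
    stdSimplexHomeomorphUnitInterval.symm.continuous
  source' := by
    rw [← stdSimplex.map_vertex]
    congr 1
    rw [Homeomorph.symm_apply_eq]
    exact stdSimplexHomeomorphUnitInterval_zero.symm
  target' := by
    rw [← stdSimplex.map_vertex]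
    congr 1
    rw [Homeomorph.symm_apply_eq]
    exact stdSimplexHomeomorphUnitInterval_one.symm

theorem pathSimplex_map_facePath (s : C(stdSimplex ℝ (Fin 3), M)) (i : Fin 3) :
    pathSimplex ((facePath i).map s.continuous) =
      (TopCat.toSSet.obj (TopCat.of M)).δ i (triangle s) := by
  rw [pathSimplex_eq_face_iff]
  intro u
  simp [facePath]

instance : SimplyConnectedSpace (stdSimplex ℝ (Fin 3)) := by
  have : ContractibleSpace (stdSimplex ℝ (Fin 3)) :=
    (convex_stdSimplex ℝ (Fin 3)).contractibleSpace ⟨_, single_mem_stdSimplex ℝ 0⟩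
  infer_instance

/-- The standard 2-simplex is simply connected, so two of its edges compose to the third up to
homotopy; `s` carries this to `M`. -/
theorem exists_boundary_paths (s : C(stdSimplex ℝ (Fin 3), M)) :
    ∃ (x y z : M) (p : Path x y) (q : Path y z) (r : Path x z), (p.trans q).Homotopic r ∧
      pathSimplex p = (TopCat.toSSet.obj (TopCat.of M)).δ 2 (triangle s) ∧
      pathSimplex q = (TopCat.toSSet.obj (TopCat.of M)).δ 0 (triangle s) ∧
      pathSimplex r = (TopCat.toSSet.obj (TopCat.of M)).δ 1 (triangle s) := by
  let p : Path (stdSimplex.vertex 0 : stdSimplex ℝ (Fin 3)) (stdSimplex.vertex 1) := facePath 2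
  let q : Path (stdSimplex.vertex 1 : stdSimplex ℝ (Fin 3)) (stdSimplex.vertex 2) := facePath 0
  let r : Path (stdSimplex.vertex 0 : stdSimplex ℝ (Fin 3)) (stdSimplex.vertex 2) := facePath 1
  refine ⟨_, _, _, p.map s.continuous, q.map s.continuous, r.map s.continuous, ?_,
    pathSimplex_map_facePath s 2, pathSimplex_map_facePath s 0, pathSimplex_map_facePath s 1⟩
  rw [← Path.map_trans]
  exact (SimplyConnectedSpace.paths_homotopic (p.trans q) r).map s

theorem symm_trans_cancel_left {x y z : M} (a : Path.Homotopic.Quotient x y)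
    (b : Path.Homotopic.Quotient y z) : a.symm.trans (a.trans b) = b := by
  rw [← Path.Homotopic.Quotient.trans_assoc, Path.Homotopic.Quotient.symm_trans,
    Path.Homotopic.Quotient.refl_trans]

/-- Closing each 1-simplex up to a loop by chosen paths extends to a homomorphism `φ` from 1-chains
to the abelianized fundamental group. It kills boundaries of 2-simplices by `exists_boundary_paths`,
so a bounding loop has trivial image there. -/
theorem mem_commutator_of_homotopyClassChain_eq_zero [PathConnectedSpace M] {x₀ : M}
    (l : FundamentalGroup M x₀) (hl : homotopyClassChain l.toPath = 0) :
    l ∈ commutator (FundamentalGroup M x₀) := by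
  let P (y : M) : Path.Homotopic.Quotient x₀ y := .mk (PathConnectedSpace.somePath x₀ y)
  let loop {x y : M} (a : Path.Homotopic.Quotient x y) : FundamentalGroup M x₀ :=
    FundamentalGroup.fromPath (((P x).trans a).trans (P y).symm)
  let g {x y : M} (a : Path.Homotopic.Quotient x y) :
      Additive (Abelianization (FundamentalGroup M x₀)) :=
    Additive.ofMul (Abelianization.of (loop a))
  have g_trans {x y z : M} (a : Path.Homotopic.Quotient x y) (b : Path.Homotopic.Quotient y z) :
      g (a.trans b) = g a + g b := by
    -- Multiplication in `FundamentalGroup` reverses the order of concatenation.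
    have : loop (a.trans b) = loop b * loop a := by
      change ((P x).trans (a.trans b)).trans (P z).symm =
        (((P x).trans a).trans (P y).symm).trans (((P y).trans b).trans (P z).symm)
      simp only [Path.Homotopic.Quotient.trans_assoc, symm_trans_cancel_left]
    simp only [g, this, map_mul]
    rw [ofMul_mul, add_comm]
  have g_congr {x y x' y' : M} (p : Path x y) (q : Path x' y')
      (h : pathSimplex p = pathSimplex q) : g (.mk p) = g (.mk q) := by
    rw [pathSimplex_eq_pathSimplex_iff] at h
    obtain rfl : x = x' := by simpa using h 0
    obtain rfl : y = y' := by simpa using h 1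
    rw [Path.ext (funext h)]
  obtain ⟨φ, hφ⟩ := exists_simplexChain_lift (M := M) (n := 1)
    fun σ => g (.mk (simplexPath σ))
  have hφ' {x y : M} (p : Path x y) : φ (pathChain p) = g (.mk p) :=
    (hφ _).trans (g_congr _ _ (pathSimplex_simplexPath _))
  have hd (c : (singularChains M).X 2) : φ (((singularChains M).d 2 1).hom c) = 0 := by
    have : φ.comp ((singularChains M).d 2 1).hom.toAddMonoidHom = 0 := by
      refine simplexChain_ext fun σ => ?_
      obtain ⟨s, rfl⟩ := (TopCat.toSSetObjEquiv (TopCat.of M) (.op (.mk 2))).symm.surjective σ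
      obtain ⟨x, y, z, p, q, r, hh, hp, hq, hr⟩ := exists_boundary_paths s
      refine (congrArg φ (boundary_triangle s p q r hp hq hr)).trans ?_
      rw [map_sub, map_add, hφ', hφ', hφ', ← Path.Homotopic.Quotient.eq.2 hh,
        Path.Homotopic.Quotient.mk_trans, g_trans, sub_self, AddMonoidHom.zero_apply]
    exact DFunLike.congr_fun this c
  have hg : g l.toPath = 0 := by
    obtain ⟨p, hp⟩ := Path.Homotopic.Quotient.mk_surjective l.toPath
    rw [← hp, homotopyClassChain_mk, pathClass, pOpcycles_eq_zero_iff] at hl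
    obtain ⟨c, hc⟩ := hl
    rw [← hp, ← hφ', ← hc, hd]
  -- The chosen path from `x₀` to itself need not be constant, so `φ` sees a conjugate of `l`, which
  -- is harmless after abelianization.
  let a := FundamentalGroup.fromPath (P x₀)
  have hg' : Abelianization.of (a⁻¹ * (l * a)) = 1 := hg
  rw [← Abelianization.ker_of, MonoidHom.mem_ker, ← hg']
  simp only [map_mul, map_inv]
  rw [mul_comm, mul_inv_cancel_right]

end Hurewicz

/-! ### Local path structure of a manifold with boundary -/

section LocalPaths

/-- Any two paths in `U` with the same endpoints are homotopic in the ambient space. -/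
def HasHomotopicPaths {M : Type*} [TopologicalSpace M] (U : Set M) : Prop :=
  ∀ ⦃a b : M⦄ (p q : Path a b), (∀ t, p t ∈ U) → (∀ t, q t ∈ U) → p.Homotopic q

variable {E H : Type*} [NormedAddCommGroup E] [NormedSpace ℝ E] [TopologicalSpace H]
  (I : ModelWithCorners ℝ E H) {M : Type*} [TopologicalSpace M] [ChartedSpace H M]

-- In an extended chart, a small ball meets the range of `I` in a convex set `C` contained in the
-- chart's target, also at boundary points. Paths in `U` are moved to `C`, compared there, and
-- mapped back.
include I in
theorem exists_isOpen_hasHomotopicPaths (y : M) :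
    ∃ U : Set M, IsOpen U ∧ y ∈ U ∧ HasHomotopicPaths U ∧ ∀ z ∈ U, Joined y z := by
  let φ := extChartAt I y
  obtain ⟨ε, hε, hsub⟩ := Metric.mem_nhdsWithin_iff.1 (extChartAt_target_mem_nhdsWithin (I := I) y)
  let C : Set E := Metric.ball (φ y) ε ∩ Set.range I
  have hC : Convex ℝ C := (convex_ball _ _).inter I.convex_range
  let U : Set M := φ.source ∩ φ ⁻¹' Metric.ball (φ y) ε
  have hU : IsOpen U :=
    (continuousOn_extChartAt y).isOpen_inter_preimage (isOpen_extChartAt_source y)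
      Metric.isOpen_ball
  have hyU : y ∈ U := ⟨mem_extChartAt_source y, Metric.mem_ball_self hε⟩
  have hUC {z : M} (hz : z ∈ U) : φ z ∈ C :=
    ⟨hz.2, extChartAt_target_subset_range y (φ.map_source hz.1)⟩
  have : ContractibleSpace C := hC.contractibleSpace ⟨φ y, hUC hyU⟩
  let ψ : C(C, M) := ⟨fun e => φ.symm e, (continuousOn_extChartAt_symm y).comp_continuous
    continuous_subtype_val fun e => hsub e.2⟩
  have hψ {z : M} (hz : z ∈ U) : z = ψ ⟨φ z, hUC hz⟩ := (φ.left_inv hz.1).symm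
  refine ⟨U, hU, hyU, ?_, fun z hz => ?_⟩
  · intro a b p q hp hq
    have ha : a ∈ U := by simpa using hp 0
    have hb : b ∈ U := by simpa using hp 1
    let push (r : Path a b) (hr : ∀ t, r t ∈ U) :
        Path (⟨φ a, hUC ha⟩ : C) ⟨φ b, hUC hb⟩ :=
      { toFun := fun t => ⟨φ (r t), hUC (hr t)⟩
        continuous_toFun := Continuous.subtype_mk ((continuousOn_extChartAt y).comp_continuous
          r.continuous fun t => (hr t).1) _
        source' := by simp
        target' := by simp }
    have push_map (r : Path a b) (hr : ∀ t, r t ∈ U) :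
        ((push r hr).map ψ.continuous).cast (hψ ha) (hψ hb) = r := by
      ext t
      exact (hψ (hr t)).symm
    rw [← push_map p hp, ← push_map q hq]
    exact ((SimplyConnectedSpace.paths_homotopic (push p hp) (push q hq)).map ψ).pathCast _ _
  · rw [hψ hyU, hψ hz]
    exact (PathConnectedSpace.joined _ _).map ψ.continuous

include I in
theorem pathConnectedSpace_of_chartedSpace [ConnectedSpace M] : PathConnectedSpace M := by
  refine ⟨inferInstance, fun x y => ?_⟩
  have hopen (x : M) : IsOpen {z | Joined x z} := by
    refine isOpen_iff_mem_nhds.2 fun z hz => ?_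
    obtain ⟨U, hU, hzU, -, hj⟩ := exists_isOpen_hasHomotopicPaths I z
    exact Filter.mem_of_superset (hU.mem_nhds hzU) fun w hw => Joined.trans hz (hj w hw)
  have hclosed : IsClosed {z | Joined x z} := by
    refine isOpen_compl_iff.1 (isOpen_iff_mem_nhds.2 fun z hz => ?_)
    exact Filter.mem_of_superset ((hopen z).mem_nhds (Joined.refl z)) fun w hw hxw =>
      hz (Joined.trans hxw (Joined.symm hw))
  have := IsClopen.eq_univ ⟨hclosed, hopen x⟩ ⟨x, Joined.refl x⟩
  exact (this ▸ Set.mem_univ y : y ∈ {z | Joined x z})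

end LocalPaths

/-! ### The Abelian cover: fibres, topology and lifts -/

section Cover

variable {M : Type u} [TopologicalSpace M] {x₀ : M}

theorem homotopyQuotient_map_trans (f : C(M, M)) {x y z : M} (a : Path.Homotopic.Quotient x y)
    (b : Path.Homotopic.Quotient y z) : (a.trans b).map f = (a.map f).trans (b.map f) := by
  refine Path.Homotopic.Quotient.ind₂ (fun p q => ?_) a b
  exact congrArg Path.Homotopic.Quotient.mk (Path.map_trans p q f.continuous)

namespace UniversalCover

theorem isOpen_sheet (a : UniversalCover x₀) {U : Set M} (hU : IsOpen U) (ha : a.endpoint ∈ U) :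
    IsOpen (a.sheet U) :=
  TopologicalSpace.isOpen_generateFrom_of_mem ⟨a, U, hU, ha, rfl⟩

theorem mem_sheet_self (a : UniversalCover x₀) {U : Set M} (ha : a.endpoint ∈ U) :
    a ∈ a.sheet U :=
  ⟨Path.refl _, fun _ => ha, (Path.Homotopic.Quotient.trans_refl _).symm⟩

theorem endpoint_mem_of_mem_sheet {a b : UniversalCover x₀} {U : Set M} (h : b ∈ a.sheet U) :
    b.endpoint ∈ U := by
  obtain ⟨η, hη, -⟩ := h
  simpa using hη 1

theorem mk_trans_mem_sheet {a : UniversalCover x₀} {U : Set M} {y z : M}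
    {b : Path.Homotopic.Quotient x₀ y} (h : ⟨y, b⟩ ∈ a.sheet U) (ζ : Path y z)
    (hζ : ∀ t, ζ t ∈ U) : ⟨z, b.trans (.mk ζ)⟩ ∈ a.sheet U := by
  obtain ⟨(η : Path a.endpoint y), hη, (hb : b = _)⟩ := h
  refine ⟨η.trans ζ, fun t => ?_, ?_⟩
  · rw [Path.trans_apply]
    split_ifs
    exacts [hη _, hζ _]
  · exact (congrArg (·.trans (.mk ζ)) hb).trans
      (Path.Homotopic.Quotient.trans_assoc a.cls (.mk η) (.mk ζ))

theorem mk_cast {y y' : M} (a : Path.Homotopic.Quotient x₀ y) (h : y' = y) :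
    (⟨y', a.cast rfl h⟩ : UniversalCover x₀) = ⟨y, a⟩ := by
  subst h
  simp

/-- The map `[α] ↦ [c · f α]` of the universal cover. -/
def lift (f : C(M, M)) (c : Path.Homotopic.Quotient x₀ (f x₀)) (a : UniversalCover x₀) :
    UniversalCover x₀ :=
  ⟨f a.endpoint, c.trans (a.cls.map f)⟩

theorem continuous_lift (f : C(M, M)) (c : Path.Homotopic.Quotient x₀ (f x₀)) :
    Continuous (lift f c) := by
  refine continuous_generateFrom_iff.2 ?_
  rintro _ ⟨a, U, hU, -, rfl⟩
  refine isOpen_iff_forall_mem_open.2 fun b hb => ?_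
  have hbU := endpoint_mem_of_mem_sheet hb
  refine ⟨b.sheet (f ⁻¹' U), ?_, b.isOpen_sheet (hU.preimage f.continuous) hbU,
    b.mem_sheet_self hbU⟩
  rintro ⟨z, d⟩ ⟨(ζ : Path b.endpoint z), hζ, (hd : d = b.cls.trans (.mk ζ))⟩
  subst hd
  change ⟨f z, c.trans ((b.cls.trans (.mk ζ)).map f)⟩ ∈ a.sheet U
  rw [homotopyQuotient_map_trans, ← Path.Homotopic.Quotient.trans_assoc]
  exact mk_trans_mem_sheet hb (ζ.map f.continuous) hζ

/-- The base point of the universal cover: the class of the constant path. -/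
def base (x₀ : M) : UniversalCover x₀ := ⟨x₀, .refl x₀⟩

/-- The initial segments of `α` trace a path in the universal cover from the base point to `[α]`.
For `s` near `t`, the piece of `α` between them stays in `U`, so the point remains in the same
sheet. -/
theorem continuous_initialPaths {y : M} (α : Path x₀ y) :
    Continuous fun t : unitInterval => (⟨α t, (Path.Homotopic.Quotient.mk (α.subpath 0 t)).cast
      α.source.symm rfl⟩ : UniversalCover x₀) := by
  refine continuous_generateFrom_iff.2 ?_
  rintro _ ⟨a, U, hU, -, rfl⟩
  refine Metric.isOpen_iff.2 fun t ht => ?_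
  have htU : α t ∈ U := endpoint_mem_of_mem_sheet ht
  obtain ⟨ε, hε, hsub⟩ := Metric.isOpen_iff.1 (hU.preimage α.continuous) t htU
  refine ⟨ε, hε, fun s hs => ?_⟩
  have h : Path.Homotopic.Quotient.mk (α.subpath 0 s) =
      (Path.Homotopic.Quotient.mk (α.subpath 0 t)).trans (.mk (α.subpath t s)) :=
    (Path.Homotopic.Quotient.eq.2 ⟨Path.Homotopy.subpathTransSubpath α 0 t s⟩).symm
  have hcast {x x' y z : M} (h : x' = x) (a : Path.Homotopic.Quotient x y)
      (b : Path.Homotopic.Quotient y z) :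
      (a.trans b).cast h rfl = (a.cast h rfl).trans b := by
    subst h; simp
  change ⟨α s, (Path.Homotopic.Quotient.mk (α.subpath 0 s)).cast _ _⟩ ∈ a.sheet U
  rw [h, hcast]
  refine mk_trans_mem_sheet ht _ fun r => ?_
  obtain ⟨v, hv, hvr⟩ : α.subpath t s r ∈ α '' Set.uIcc t s := by
    rw [← Path.range_subpath]; exact Set.mem_range_self r
  rw [← hvr]
  refine hsub (Metric.mem_ball.2 (lt_of_le_of_lt ?_ hs))
  have hv' : (v : ℝ) ∈ Set.uIcc (t : ℝ) s := by
    rcases Set.mem_uIcc.1 hv with h | h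
    exacts [Set.mem_uIcc.2 (.inl h), Set.mem_uIcc.2 (.inr h)]
  exact Set.abs_sub_left_of_mem_uIcc hv'

theorem joined_base (a : UniversalCover x₀) : Joined (base x₀) a := by
  obtain ⟨y, a⟩ := a
  induction a with | mk α => ?_
  refine ⟨⟨⟨_, continuous_initialPaths α⟩, ?_, ?_⟩⟩
  · have h (z : M) (hz : x₀ = z) : (⟨z, (Path.Homotopic.Quotient.mk (Path.refl z)).cast hz rfl⟩ :
        UniversalCover x₀) = base x₀ := by
      subst hz; simp [base]
    change (⟨α 0, (Path.Homotopic.Quotient.mk (α.subpath 0 0)).cast _ _⟩ : UniversalCover x₀) = _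
    rw [Path.subpath_self]
    exact h _ α.source.symm
  · change (⟨α 1, (Path.Homotopic.Quotient.mk (α.subpath 0 1)).cast _ _⟩ : UniversalCover x₀) = _
    rw [Path.subpath_zero_one, Path.Homotopic.Quotient.mk_cast, Path.Homotopic.Quotient.cast_cast]
    exact mk_cast _ α.target

instance : PathConnectedSpace (UniversalCover x₀) :=
  ⟨⟨base x₀⟩, fun a b => (joined_base a).symm.trans (joined_base b)⟩

end UniversalCover

namespace AbelianCover

/-- The point of the universal Abelian cover given by a homotopy class of paths. -/
def mk {y : M} (a : Path.Homotopic.Quotient x₀ y) : AbelianCover x₀ :=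
  Quotient.mk (commutatorSetoid x₀) ⟨y, a⟩

theorem exists_mk_eq {e : AbelianCover x₀} {y : M} (h : e.proj = y) :
    ∃ a : Path.Homotopic.Quotient x₀ y, mk a = e := by
  obtain ⟨⟨z, a⟩, rfl⟩ := Quotient.exists_rep e
  obtain rfl : z = y := h
  exact ⟨a, rfl⟩

theorem deck_mk {y : M} (l : Path.Homotopic.Quotient x₀ x₀) (a : Path.Homotopic.Quotient x₀ y) :
    deck (FundamentalGroup.fromPath l) (mk a) = mk (l.trans a) := rfl

theorem homotopyClassChain_eq_zero_of_mem_commutator {l : FundamentalGroup M x₀}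
    (hl : l ∈ commutator (FundamentalGroup M x₀)) : homotopyClassChain l.toPath = 0 := by
  let φ : FundamentalGroup M x₀ →* Multiplicative (chainClasses M) :=
    { toFun := fun l => Multiplicative.ofAdd (homotopyClassChain l.toPath)
      map_one' := congrArg Multiplicative.ofAdd (homotopyClassChain_refl x₀)
      map_mul' := fun k l => congrArg Multiplicative.ofAdd
        ((homotopyClassChain_trans l.toPath k.toPath).trans (add_comm _ _)) }
  exact Multiplicative.ofAdd.injective
    (MonoidHom.mem_ker.1 (Abelianization.commutator_subset_ker φ hl))

/-- The loop $b a^{-1}$ moves `a` to `b` and has class $b-a$; by Hurewicz it lies in the commutator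
subgroup when this class is zero. -/
theorem mk_eq_mk_iff [PathConnectedSpace M] {y : M} (a b : Path.Homotopic.Quotient x₀ y) :
    mk a = mk b ↔ homotopyClassChain a = homotopyClassChain b := by
  constructor
  · intro h
    obtain ⟨l, hl, hb⟩ := Quotient.exact h
    have hb' : b = l.toPath.trans a := by
      simpa [UniversalCover.act] using hb
    rw [hb', homotopyClassChain_trans, homotopyClassChain_eq_zero_of_mem_commutator hl, zero_add]
  · intro h
    refine Quotient.sound ⟨FundamentalGroup.fromPath (b.trans a.symm),
      mem_commutator_of_homotopyClassChain_eq_zero _ ?_, ?_⟩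
    · change homotopyClassChain (b.trans a.symm) = 0
      simp [h]
    · change _ = (⟨y, (b.trans a.symm).trans a⟩ : UniversalCover x₀)
      simp

/-- The lift `[α] ↦ [c · f α]` of `f` to the universal Abelian cover. -/
def lift [PathConnectedSpace M] (f : C(M, M)) (c : Path.Homotopic.Quotient x₀ (f x₀)) :
    C(AbelianCover x₀, AbelianCover x₀) where
  toFun := Quotient.map' (s₁ := commutatorSetoid x₀) (s₂ := commutatorSetoid x₀)
    (UniversalCover.lift f c) (by
      rintro a b ⟨l, hl, rfl⟩
      refine Quotient.exact ((mk_eq_mk_iff (c.trans (a.cls.map f))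
        (c.trans ((l.toPath.trans a.cls).map f))).2 ?_)
      simp [homotopyClassChain_eq_zero_of_mem_commutator hl])
  continuous_toFun := (UniversalCover.continuous_lift f c).quotient_map' _

theorem lift_mk [PathConnectedSpace M] (f : C(M, M)) (c : Path.Homotopic.Quotient x₀ (f x₀))
    {y : M} (a : Path.Homotopic.Quotient x₀ y) : lift f c (mk a) = mk (c.trans (a.map f)) := rfl

theorem isLift_lift [PathConnectedSpace M] (f : C(M, M)) (c : Path.Homotopic.Quotient x₀ (f x₀)) :
    IsLift f (lift f c) := by
  intro e
  obtain ⟨a, ha⟩ := exists_mk_eq (e := e) rfl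
  rw [← ha]
  rfl

instance : PathConnectedSpace (AbelianCover x₀) :=
  inferInstanceAs (PathConnectedSpace (Quotient (commutatorSetoid x₀)))

/-- The image of a sheet of the universal cover. -/
def sheet (a : UniversalCover x₀) (U : Set M) : Set (AbelianCover x₀) :=
  Quotient.mk (commutatorSetoid x₀) '' a.sheet U

theorem isOpen_sheet (a : UniversalCover x₀) {U : Set M} (hU : IsOpen U) (ha : a.endpoint ∈ U) :
    IsOpen (sheet a U) := by
  refine isOpen_coinduced.2 (isOpen_iff_forall_mem_open.2 ?_)
  rintro b ⟨⟨z, d⟩, ⟨(η : Path a.endpoint z), hη, (hd : d = a.cls.trans (.mk η))⟩, hdb⟩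
  subst hd
  obtain ⟨l, hl, rfl⟩ := Quotient.exact hdb
  -- The preimage of the image of a sheet is the union of its translates by commutator elements,
  -- each of them again a sheet.
  refine ⟨(a.act l).sheet U, ?_, UniversalCover.isOpen_sheet (a.act l) hU ha, η, hη, ?_⟩
  · rintro ⟨z, e⟩ ⟨(ζ : Path a.endpoint z), hζ, (he : e = (a.act l).cls.trans (.mk ζ))⟩
    subst he
    refine ⟨⟨z, a.cls.trans (.mk ζ)⟩, ⟨ζ, hζ, rfl⟩, Quotient.sound ⟨l, hl, ?_⟩⟩
    exact congrArg (UniversalCover.mk z)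
      (Path.Homotopic.Quotient.trans_assoc l.toPath a.cls (.mk ζ))
  · exact (Path.Homotopic.Quotient.trans_assoc l.toPath a.cls (.mk η)).symm

theorem exists_mk_of_mem_sheet {a : UniversalCover x₀} {U : Set M} {e : AbelianCover x₀}
    (he : e ∈ sheet a U) {z : M} (hz : e.proj = z) :
    ∃ η : Path a.endpoint z, (∀ t, η t ∈ U) ∧ e = mk (a.cls.trans (.mk η)) := by
  obtain ⟨⟨w, d⟩, ⟨η, hη, hd⟩, rfl⟩ := he
  obtain rfl : w = z := hz
  exact ⟨η, hη, congrArg mk hd⟩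

theorem isLocallyInjective_proj
    (hM : ∀ y : M, ∃ U : Set M, IsOpen U ∧ y ∈ U ∧ HasHomotopicPaths U) :
    IsLocallyInjective (proj (x₀ := x₀)) := by
  intro e
  obtain ⟨a, rfl⟩ := Quotient.exists_rep e
  obtain ⟨U, hU, haU, hp⟩ := hM a.endpoint
  refine ⟨sheet a U, isOpen_sheet a hU haU, ⟨a, a.mem_sheet_self haU, rfl⟩, fun e he e' he' h => ?_⟩
  obtain ⟨η, hη, h₁⟩ := exists_mk_of_mem_sheet he h
  obtain ⟨ζ, hζ, h₂⟩ := exists_mk_of_mem_sheet he' rfl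
  rw [Path.Homotopic.Quotient.eq.2 (hp η ζ hη hζ)] at h₁
  exact h₁.trans h₂.symm

/-- If sheets around two points of a fibre met, the two connecting paths in `U` would be homotopic
and their classes would cancel, so the points would be equal. -/
theorem isSeparatedMap_proj [PathConnectedSpace M]
    (hM : ∀ y : M, ∃ U : Set M, IsOpen U ∧ y ∈ U ∧ HasHomotopicPaths U) :
    IsSeparatedMap (proj (x₀ := x₀)) := by
  intro e e' h hne
  obtain ⟨a, rfl⟩ := exists_mk_eq h
  obtain ⟨b, hb⟩ := exists_mk_eq (e := e') rfl
  obtain ⟨U, hU, hyU, hp⟩ := hM (proj e')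
  refine ⟨sheet ⟨_, a⟩ U, sheet ⟨_, b⟩ U, isOpen_sheet _ hU hyU, isOpen_sheet _ hU hyU,
    ⟨_, UniversalCover.mem_sheet_self _ hyU, rfl⟩, ⟨_, UniversalCover.mem_sheet_self _ hyU, hb⟩,
    Set.disjoint_left.2 fun d hd hd' => hne ?_⟩
  obtain ⟨η, hη, h₁⟩ := exists_mk_of_mem_sheet hd rfl
  obtain ⟨ζ, hζ, h₂⟩ := exists_mk_of_mem_sheet hd' rfl
  have h₃ := (mk_eq_mk_iff _ _).1 (h₁.symm.trans h₂)
  rw [Path.Homotopic.Quotient.eq.2 (hp η ζ hη hζ)] at h₃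
  simp only [homotopyClassChain_trans] at h₃
  exact ((mk_eq_mk_iff a b).2 (add_right_cancel h₃)).trans hb

/-- The path `c` is read off from the image of the base point. Two lifts that agree there are equal,
because the projection is separated and locally injective and the cover is connected. -/
theorem exists_eq_lift [PathConnectedSpace M]
    (hM : ∀ y : M, ∃ U : Set M, IsOpen U ∧ y ∈ U ∧ HasHomotopicPaths U) {f : C(M, M)}
    {F : C(AbelianCover x₀, AbelianCover x₀)} (hF : IsLift f F) : ∃ c, F = lift f c := by
  obtain ⟨c, hc⟩ := exists_mk_eq (y := f x₀) (hF (mk (.refl x₀)))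
  refine ⟨c, DFunLike.coe_injective ?_⟩
  refine (isSeparatedMap_proj hM).eq_of_comp_eq (isLocallyInjective_proj hM) F.continuous
    (lift f c).continuous (funext fun e => ?_) (mk (.refl x₀)) ?_
  · exact (hF e).trans (isLift_lift f c e).symm
  · rw [← hc]
    refine (mk_eq_mk_iff c (c.trans ((Path.Homotopic.Quotient.refl x₀).map f))).2 ?_
    simp

end AbelianCover

end Cover

/-! ### Lifts and displacements as linear equations -/

section Displacement

variable {M : Type u} [TopologicalSpace M] {x₀ : M}

theorem AbelianCover.mk_cast {y y' : M} (a : Path.Homotopic.Quotient x₀ y) (h : y' = y) :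
    mk (a.cast rfl h) = mk a := by
  subst h
  simp

theorem AbelianCover.lift_mk_eq_mk_iff [PathConnectedSpace M] (f : C(M, M))
    (c : Path.Homotopic.Quotient x₀ (f x₀)) {x : M} (hx : f x = x)
    (a b : Path.Homotopic.Quotient x₀ x) :
    lift f c (mk a) = mk b ↔
      homotopyClassChain c + chainClassesMap f (homotopyClassChain a) = homotopyClassChain b := by
  rw [lift_mk, ← mk_cast _ hx.symm, mk_eq_mk_iff]
  simp

variable {b : ℕ} (Γ : Module.Basis (Fin b) ℤ (H1 M))

/-- The homology class with given coordinates. -/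
def homologyOfCoords : (Fin b → ℤ) →+ H1 M where
  toFun n := ∑ i, n i • Γ i
  map_zero' := by simp
  map_add' n m := by
    simp only [Pi.add_apply, add_zsmul, Finset.sum_add_distrib]

theorem homologyOfCoords_eq (n : Fin b → ℤ) : homologyOfCoords Γ n = Γ.equivFun.symm n := by
  rw [Module.Basis.equivFun_symm_apply]
  change ∑ i, n i • Γ i = _
  exact Finset.sum_congr rfl fun i _ => (int_smul_eq_zsmul (H1 M).isModule (n i) (Γ i)).symm

theorem homologyOfCoords_surjective : Function.Surjective (homologyOfCoords Γ) := fun h =>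
  ⟨Γ.equivFun h, by rw [homologyOfCoords_eq, LinearEquiv.symm_apply_apply]⟩

theorem homologyOfCoords_mulVec (f : C(M, M)) (m : Fin b → ℤ) :
    homologyOfCoords Γ ((homologyMatrix Γ f - 1).mulVec m) =
      H1map f (homologyOfCoords Γ m) - homologyOfCoords Γ m := by
  rw [Matrix.sub_mulVec, Matrix.one_mulVec, map_sub]
  congr 1
  rw [homologyOfCoords_eq, LinearEquiv.symm_apply_eq]
  have h := LinearMap.toMatrix_mulVec_repr Γ Γ (H1map f) (Γ.equivFun.symm m)
  rw [homologyOfCoords_eq, Module.Basis.equivFun_apply, ← h]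
  congr 1
  rw [← Module.Basis.equivFun_apply, LinearEquiv.apply_symm_apply]

/-- One point of the fibre suffices: another point `a₁` differs from `a` by a homology class with
coordinates `m`, which changes `n` by $(A-I)m$. -/
theorem isDisplacement_lift_iff [PathConnectedSpace M] {f : C(M, M)}
    {c : Path.Homotopic.Quotient x₀ (f x₀)} {x : M} (hx : f x = x)
    (a : Path.Homotopic.Quotient x₀ x) (d : BF1 Γ f) :
    IsDisplacement Γ f (AbelianCover.lift f c) x d ↔
      ∃ n : Fin b → ℤ, homotopyClassChain c + chainClassesMap f (homotopyClassChain a) =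
        homologyInclusion M (homologyOfCoords Γ n) + homotopyClassChain a ∧
        (imageAsubI Γ f).mkQ n = d := by
  constructor
  · intro h
    obtain ⟨n, δ, ⟨l, hl, rfl⟩, he, hd⟩ := h (AbelianCover.mk a) rfl
    refine ⟨n, ?_, hd⟩
    rw [AbelianCover.deck_mk, AbelianCover.lift_mk_eq_mk_iff f c hx] at he
    rw [isHomologyClass_iff] at hl
    rw [he, homotopyClassChain_trans, homotopyClassChain_mk, ← hl]
    rfl
  · rintro ⟨n, hn, rfl⟩ e he
    obtain ⟨a₁, rfl⟩ := AbelianCover.exists_mk_eq he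
    obtain ⟨h, hh⟩ := exists_homologyInclusion_eq (a₁.trans a.symm)
    obtain ⟨m, rfl⟩ := homologyOfCoords_surjective Γ h
    rw [homotopyClassChain_trans, homotopyClassChain_symm, ← sub_eq_add_neg] at hh
    -- The loop $c\cdot f(a_1)\cdot a_1^{-1}$ is the one whose deck transformation carries `a₁` to
    -- its image.
    obtain ⟨l, hl⟩ := Path.Homotopic.Quotient.mk_surjective
      (((c.trans (a₁.map f)).cast rfl hx.symm).trans a₁.symm)
    refine ⟨n + (homologyMatrix Γ f - 1).mulVec m, _, ⟨l, ?_, rfl⟩, ?_, ?_⟩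
    · refine (isHomologyClass_iff l (homologyOfCoords Γ _)).2 ?_
      rw [map_add, homologyOfCoords_mulVec, map_add, map_sub, ← chainClassesMap_homologyInclusion,
        hh, ← homotopyClassChain_mk, hl]
      simp only [homotopyClassChain_trans, homotopyClassChain_symm, homotopyClassChain_cast,
        homotopyClassChain_map, map_sub]
      rw [← sub_eq_iff_eq_add.2 hn]
      abel
    · rw [AbelianCover.deck_mk, AbelianCover.lift_mk_eq_mk_iff f c hx, hl]
      simp
    · rw [map_add, add_eq_left, Submodule.mkQ_apply, Submodule.Quotient.mk_eq_zero]
      exact ⟨m, rfl⟩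

end Displacement

end

end AbelianDisplacement

/-! ### The equivalence -/

theorem mainTheorem7 {E H : Type*} [NormedAddCommGroup E] [NormedSpace ℝ E]
    [FiniteDimensional ℝ E] [TopologicalSpace H] (I : ModelWithCorners ℝ E H)
    {M : Type u} [TopologicalSpace M] [T2Space M] [CompactSpace M] [ConnectedSpace M]
    [ChartedSpace H M] [IsManifold I ∞ M]
    {b : ℕ} (Γ : Module.Basis (Fin b) ℤ (AbelianDisplacement.H1 M))
    (x₀ : M) (f : C(M, M)) (x x' : M) (hx : f x = x) (hx' : f x' = x') :
    List.TFAE [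
      -- equal displacements with respect to some lift of `f`
      ∃ F : C(AbelianDisplacement.AbelianCover x₀, AbelianDisplacement.AbelianCover x₀),
        AbelianDisplacement.IsLift f F ∧
        ∃ d : AbelianDisplacement.BF1 Γ f,
          AbelianDisplacement.IsDisplacement Γ f F x d ∧
          AbelianDisplacement.IsDisplacement Γ f F x' d,
      -- some lift of `f` fixes lifts of both points
      ∃ F : C(AbelianDisplacement.AbelianCover x₀, AbelianDisplacement.AbelianCover x₀),
        AbelianDisplacement.IsLift f F ∧
        ∃ e e' : AbelianDisplacement.AbelianCover x₀,
          e.proj = x ∧ e'.proj = x' ∧ F e = e ∧ F e' = e',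
      -- some arc from `x` to `x'` is homologous to its image rel endpoints
      ∃ γ : Path x x',
        AbelianDisplacement.HomologousRel γ ((γ.map f.continuous).cast hx.symm hx'.symm)] := by
  open AbelianDisplacement in
  have : PathConnectedSpace M := pathConnectedSpace_of_chartedSpace I
  have hM (y : M) : ∃ U : Set M, IsOpen U ∧ y ∈ U ∧ HasHomotopicPaths U := by
    obtain ⟨U, hU, hyU, hp, -⟩ := exists_isOpen_hasHomotopicPaths I y
    exact ⟨U, hU, hyU, hp⟩
  tfae_have 1 → 2 := by
    rintro ⟨F, hF, d, h, h'⟩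
    obtain ⟨c, rfl⟩ := AbelianCover.exists_eq_lift hM hF
    let a : Path.Homotopic.Quotient x₀ x := .mk (PathConnectedSpace.somePath x₀ x)
    let a' : Path.Homotopic.Quotient x₀ x' := .mk (PathConnectedSpace.somePath x₀ x')
    obtain ⟨n, hn, hd⟩ := (isDisplacement_lift_iff Γ hx a d).1 h
    obtain ⟨n', hn', hd'⟩ := (isDisplacement_lift_iff Γ hx' a' d).1 h'
    obtain ⟨m, hm⟩ : n' - n ∈ imageAsubI Γ f := by
      rw [← Submodule.Quotient.mk_eq_zero, Submodule.Quotient.mk_sub, sub_eq_zero]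
      exact hd'.trans hd.symm
    obtain ⟨l, hl⟩ := exists_homotopyClassChain_eq x₀ (homologyOfCoords Γ n)
    obtain ⟨k, hk⟩ := exists_homotopyClassChain_eq x₀ (homologyOfCoords Γ m)
    have hnm := congrArg (homologyInclusion M) (homologyOfCoords_mulVec Γ f m)
    rw [← Matrix.mulVecLin_apply, hm, map_sub, map_sub, map_sub,
      ← chainClassesMap_homologyInclusion] at hnm
    -- Subtracting `n` from `c` makes the lift fix `a`. Over `x'` the remaining displacement is
    -- $n'-n=(A-I)m$, and it is absorbed by moving `a'` to $a'-m$.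
    refine ⟨AbelianCover.lift f (l.symm.trans c), AbelianCover.isLift_lift _ _,
      AbelianCover.mk a, AbelianCover.mk (k.symm.trans a'), rfl, rfl, ?_, ?_⟩
    · rw [AbelianCover.lift_mk_eq_mk_iff f _ hx, homotopyClassChain_trans, add_assoc, hn,
        homotopyClassChain_symm, hl, neg_add_cancel_left]
    · rw [AbelianCover.lift_mk_eq_mk_iff f _ hx']
      simp only [homotopyClassChain_trans, homotopyClassChain_symm, map_add, map_neg, hl, hk]
      rw [← eq_sub_iff_add_eq'] at hn'
      rw [hn', ← sub_eq_zero]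
      rw [← sub_eq_zero] at hnm
      rw [← hnm]
      abel
  tfae_have 2 → 1 := by
    rintro ⟨F, hF, e, e', he, he', hFe, hFe'⟩
    obtain ⟨c, rfl⟩ := AbelianCover.exists_eq_lift hM hF
    obtain ⟨a, rfl⟩ := AbelianCover.exists_mk_eq he
    obtain ⟨a', rfl⟩ := AbelianCover.exists_mk_eq he'
    rw [AbelianCover.lift_mk_eq_mk_iff f c hx] at hFe
    rw [AbelianCover.lift_mk_eq_mk_iff f c hx'] at hFe'
    exact ⟨_, hF, 0, (isDisplacement_lift_iff Γ hx a 0).2 ⟨0, by simp [hFe], map_zero _⟩,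
      (isDisplacement_lift_iff Γ hx' a' 0).2 ⟨0, by simp [hFe'], map_zero _⟩⟩
  tfae_have 2 → 3 := by
    rintro ⟨F, hF, e, e', he, he', hFe, hFe'⟩
    obtain ⟨c, rfl⟩ := AbelianCover.exists_eq_lift hM hF
    obtain ⟨a, rfl⟩ := AbelianCover.exists_mk_eq he
    obtain ⟨a', rfl⟩ := AbelianCover.exists_mk_eq he'
    rw [AbelianCover.lift_mk_eq_mk_iff f c hx] at hFe
    rw [AbelianCover.lift_mk_eq_mk_iff f c hx'] at hFe'
    obtain ⟨γ, hγ⟩ := Path.Homotopic.Quotient.mk_surjective (a.symm.trans a')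
    refine ⟨γ, ?_⟩
    rw [homologousRel_iff, pathClass_cast]
    have h := homotopyClassChain_map f (Path.Homotopic.Quotient.mk γ)
    rw [← Path.Homotopic.Quotient.mk_map, homotopyClassChain_mk, homotopyClassChain_mk] at h
    rw [h, ← homotopyClassChain_mk, hγ, homotopyClassChain_trans, homotopyClassChain_symm, map_add,
      map_neg, eq_sub_iff_add_eq'.2 hFe, eq_sub_iff_add_eq'.2 hFe']
    abel
  tfae_have 3 → 2 := by
    rintro ⟨γ, hγ⟩
    rw [homologousRel_iff, pathClass_cast] at hγ
    have h := homotopyClassChain_map f (Path.Homotopic.Quotient.mk γ)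
    rw [← Path.Homotopic.Quotient.mk_map, homotopyClassChain_mk, homotopyClassChain_mk, hγ] at h
    let a : Path.Homotopic.Quotient x₀ x := .mk (PathConnectedSpace.somePath x₀ x)
    -- The choice $c=a\cdot f(a)^{-1}$ solves $c+f_*a=a$; since $f_*\gamma=\gamma$ in `chainClasses
    -- M`, it also solves the equation for $a\gamma$.
    refine ⟨AbelianCover.lift f (a.trans ((a.map f).cast rfl hx.symm).symm),
      AbelianCover.isLift_lift _ _, AbelianCover.mk a, AbelianCover.mk (a.trans (.mk γ)), rfl, rfl,
      ?_, ?_⟩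
    · rw [AbelianCover.lift_mk_eq_mk_iff f _ hx]
      simp
    · rw [AbelianCover.lift_mk_eq_mk_iff f _ hx']
      simp [← h]
  tfae_finish
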